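/- Let $M$ be a monoid with identity $\mathbf 1$. For $x,y\in M$ write $x\preccurlyeq y$ if $y=xu$ for some $u\in M$ ($x$ is a left-divisor of $y$), and $y\succcurlyeq x$ if $y=ux$ for some $u\in M$ ($x$ is a right-divisor of $y$). An element $a\neq\mathbf 1$ of $M$ is an \emph{atom} if $a=uv$ with $u,v\in M$ implies $u=\mathbf 1$ or $v=\mathbf 1$; $M$ is \emph{atomic} if it is generated by its atoms and, for every $x\in M$, the lengths of the expressions of $x$ as a product of atoms are bounded. $M$ is a \emph{Garside monoid} if it is cancellative and atomic, any two elements have a unique least common upper bound and a unique greatest common lower bound with respect to left-divisibility, and likewise with respect to right-divisibility, and there is an element $\Delta\in M$ whose set of left-divisors equals its set of right-divisors, is finite, and generates $M$. For elements $x,y$ of a Garside monoid $M$, let $x\vee y$ be their least common upper bound with respect to $\preccurlyeq$, let $y\backslash x$ be the unique element with $y\,(y\backslash x)=x\vee y$, and let $\Delta_x=\bigvee\{\,y\backslash x : y\in M\,\}$, the join with respect to $\preccurlyeq$. $M$ is \emph{$\Delta$-pure} if $\Delta_a=\Delta_b$ for all atoms $a,b$ of $M$. $M$ is the \emph{Zappa--Sz\'ep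 product} of two submonoids $G$ and $H$ if for every $k\in M$ there exist unique $g_1,g_2\in G$ and $h_1,h_2\in H$ such that $g_1h_1=k=h_2g_2$. \textbf{Theorem.} A Garside monoid $M$ is $\Delta$-pure if and only if it cannot be written as the Zappa--Sz\'ep product of two non-trivial submonoids, where a submonoid is non-trivial if it is different from $\{\mathbf 1\}$. -/

import Mathlib

namespace Garside

variable {M : Type*} [Monoid M]

/-! Left-divisibility (the prefix order) is `∣`, that is `x ∣ y ↔ ∃ u, y = x * u`;
right-divisibility (the suffix order) is `RightDvd`, that is `∃ u, y = u * x`. -/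

/-- `z` is a least upper bound of the set `S` with respect to the relation `r`. -/
def IsJoin (r : M → M → Prop) (S : Set M) (z : M) : Prop :=
  (∀ s ∈ S, r s z) ∧ ∀ w : M, (∀ s ∈ S, r s w) → r z w

/-- `z` is a greatest lower bound of the set `S` with respect to the relation `r`. -/
def IsMeet (r : M → M → Prop) (S : Set M) (z : M) : Prop :=
  (∀ s ∈ S, r z s) ∧ ∀ w : M, (∀ s ∈ S, r w s) → r w z

/-- Any two elements have a unique least common upper bound and a unique greatest common
lower bound with respect to `r`. -/
def HasLatticeProperty (r : M → M → Prop) : Prop :=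
  ∀ x y : M, (∃! z : M, IsJoin r {x, y} z) ∧ (∃! z : M, IsMeet r {x, y} z)

/-- Atoms of a monoid. -/
def IsMonoidAtom (a : M) : Prop :=
  a ≠ 1 ∧ ∀ u v : M, a = u * v → u = 1 ∨ v = 1

variable (M) in
/-- A monoid is atomic if it is generated by its atoms and, for every element, the lengths of
its decompositions as a product of atoms are bounded. -/
def IsAtomicMonoid : Prop :=
  Submonoid.closure {a : M | IsMonoidAtom a} = ⊤ ∧
  ∀ x : M, ∃ n : ℕ, ∀ l : List M, (∀ a ∈ l, IsMonoidAtom a) → l.prod = x → l.length ≤ n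

/-- `d` is balanced: its left-divisors are exactly its right-divisors. -/
def IsBalanced (d : M) : Prop := {x : M | x ∣ d} = {x : M | RightDvd x d}

/-- `Δ` is a Garside element, that is, `(M, Δ)` is a Garside structure. -/
structure IsGarsideElement (Δ : M) : Prop where
  cancel : IsCancelMul M
  atomic : IsAtomicMonoid M
  left_lattice : HasLatticeProperty (Dvd.dvd : M → M → Prop)
  right_lattice : HasLatticeProperty (RightDvd : M → M → Prop)
  balanced : IsBalanced Δ
  generates : Submonoid.closure {x : M | x ∣ Δ} = ⊤
  finite_divisors : {x : M | x ∣ Δ}.Finite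

variable (M) in
/-- A Garside monoid: a monoid that has some Garside element. -/
def IsGarsideMonoid : Prop := ∃ Δ : M, IsGarsideElement Δ

/-- `z` is the left complement `y \ x`, that is, `y * z` is the least common upper bound
of `x` and `y` with respect to left-divisibility. -/
def IsComplementOf (y x z : M) : Prop := IsJoin Dvd.dvd {x, y} (y * z)

/-- `d` is the element `Δ_x`: the join, with respect to left-divisibility, of all the
complements `y \ x`, where `y` ranges over `M`. -/
def IsLocalDelta (x d : M) : Prop :=
  IsJoin Dvd.dvd {z : M | ∃ y : M, IsComplementOf y x z} d

variable (M) in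
/-- `M` is `Δ`-pure: `Δ_a = Δ_b` for all atoms `a`, `b`, i.e. one and the same element is
both `Δ_a` and `Δ_b`. -/
def IsDeltaPure : Prop :=
  ∀ a b : M, IsMonoidAtom a → IsMonoidAtom b → ∃ d : M, IsLocalDelta a d ∧ IsLocalDelta b d

/-- `M` is the internal Zappa–Szép product of the submonoids `G` and `H`: every element has
a unique `GH`-decomposition and a unique `HG`-decomposition. -/
def IsZappaSzep (G H : Submonoid M) : Prop :=
  ∀ k : M, (∃! p : G × H, (p.1 : M) * (p.2 : M) = k) ∧
    (∃! q : H × G, (q.1 : M) * (q.2 : M) = k)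

variable (M) in
/-- `M` is not the Zappa–Szép product of two non-trivial submonoids. -/
def IsZappaSzepIndecomposable : Prop :=
  ¬ ∃ G H : Submonoid M, G ≠ ⊥ ∧ H ≠ ⊥ ∧ IsZappaSzep G H

end Garside

/-! For an element `x`, the element `Δ_x` is the least *quasi-central* multiple of `x`, where `e`
is quasi-central if `e ∣ v * e` for all `v`. Everything below is about quasi-central elements.

*Decomposable implies not `Δ`-pure.* Suppose that `M` is the Zappa–Szép product of `G` and `H`;
both are then closed under divisors. Write a Garside element as `Δ = p * q` with `p ∈ G` and
`q ∈ H`. Comparing decompositions of `y * Δ = Δ * y'` shows that `p` is quasi-central, and every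
atom `a ∈ G` divides `p`. Hence `Δ_a` divides `p` and lies in `G`; likewise `Δ_b ∈ H` for an atom
`b ∈ H`. As `G ∩ H` is trivial, `Δ_a ≠ Δ_b`.

*Not `Δ`-pure implies decomposable.* Conjugation by a quasi-central element is an automorphism of
`M` (finiteness of the divisor sets gives surjectivity), so the quasi-central elements are closed
under products, joins and left quotients. It follows that the `Δ_a`, for atoms `a`, are minimal
among the non-trivial quasi-central elements (`IsLocalDelta.eq_of_dvd`) and prime
(`IsLocalDelta.dvd_or_dvd`). Fix a central element `z` divisible by all atoms, an atom `a`,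
`d = Δ_a`, and write `z = d ^ m * e` with `d ∤ e`. By primality each atom divides `d` or `e`, and
no non-trivial element divides both a power of `d` and a power of `e`. Let `G` and `H` be the
submonoids of divisors of powers of `d` and of `e`. For `g ∈ G` and `h ∈ H` the join of `g` and `h`
has the form `h * g' = g * h'` with `g' ∈ G` and `h' ∈ H`, and for fixed `h` the map `g ↦ g'` is
an injection of the finite set of divisors of `d ^ j` into itself. It is therefore
surjective, so every product `h * g'` can be rewritten as `g * h'` (`exists_exchange`). Hence `M`
is the Zappa–Szép product of `G` and `H`, and `H ≠ 1` as soon as some atom `b` has `Δ_b ≠ d`. -/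

namespace Garside

variable {M : Type*} [Monoid M]

/-! ### Divisibility in atomic monoids -/

lemma dvd_of_mul_dvd_mul_left [IsCancelMul M] {a b c : M} (h : a * b ∣ a * c) : b ∣ c := by
  obtain ⟨u, hu⟩ := h
  exact ⟨u, mul_left_cancel (a := a) (by rw [hu, mul_assoc])⟩

lemma IsAtomicMonoid.exists_list (hM : IsAtomicMonoid M) (x : M) :
    ∃ l : List M, (∀ a ∈ l, IsMonoidAtom a) ∧ l.prod = x :=
  Submonoid.exists_list_of_mem_closure (hM.1 ▸ Submonoid.mem_top x)

/-- An atomic monoid has no non-trivial units: repeating a non-empty expression of `1` as a product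
of atoms would give arbitrarily long ones. -/
lemma IsAtomicMonoid.eq_one_of_mul_eq_one (hM : IsAtomicMonoid M) {u v : M} (h : u * v = 1) :
    u = 1 ∧ v = 1 := by
  obtain ⟨l, hl, rfl⟩ := hM.exists_list u
  obtain ⟨l', hl', rfl⟩ := hM.exists_list v
  obtain ⟨n, hn⟩ := hM.2 1
  have key := hn (List.replicate (n + 1) (l ++ l')).flatten
    (by
      intro a ha
      simp only [List.mem_flatten, List.mem_replicate] at ha
      obtain ⟨t, ⟨-, rfl⟩, hat⟩ := ha
      rcases List.mem_append.1 hat with h1 | h1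
      exacts [hl a h1, hl' a h1])
    (by simp [List.prod_flatten, h])
  have h0 : (l ++ l').length = 0 := by
    by_contra hne
    have h1 : n + 1 ≤ (n + 1) * (l ++ l').length := Nat.le_mul_of_pos_right _ (by omega)
    simp only [List.length_flatten, List.map_replicate, List.sum_replicate, smul_eq_mul] at key
    omega
  obtain ⟨rfl, rfl⟩ := List.append_eq_nil_iff.1 (List.length_eq_zero_iff.1 h0)
  simp

lemma IsAtomicMonoid.eq_one_of_dvd_one (hM : IsAtomicMonoid M) {u : M} (h : u ∣ 1) : u = 1 := by
  obtain ⟨v, hv⟩ := h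
  exact (hM.eq_one_of_mul_eq_one hv.symm).1

lemma IsAtomicMonoid.dvd_antisymm [IsCancelMul M] (hM : IsAtomicMonoid M) {x y : M}
    (h : x ∣ y) (h' : y ∣ x) : x = y := by
  obtain ⟨u, rfl⟩ := h
  obtain ⟨v, hv⟩ := h'
  have : u * v = 1 := mul_left_cancel (a := x) (by rw [← mul_assoc, ← hv, mul_one])
  rw [(hM.eq_one_of_mul_eq_one this).1, mul_one]

lemma IsAtomicMonoid.exists_atom_dvd (hM : IsAtomicMonoid M) {x : M} (hx : x ≠ 1) :
    ∃ a, IsMonoidAtom a ∧ a ∣ x := by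
  obtain ⟨l, hl, rfl⟩ := hM.exists_list x
  cases l with
  | nil => simp at hx
  | cons a l => exact ⟨a, hl a (by simp), by simp⟩

lemma IsMonoidAtom.mem_of_prod_eq {a : M} (ha : IsMonoidAtom a) :
    ∀ l : List M, l.prod = a → a ∈ l
  | [], h => absurd h.symm ha.1
  | x :: l, h => by
    rw [List.prod_cons] at h
    rcases ha.2 _ _ h.symm with h1 | h1
    · rw [h1, one_mul] at h
      exact List.mem_cons_of_mem _ (ha.mem_of_prod_eq l h)
    · rw [h1, mul_one] at h
      simp [h]

/-- The divisors of `x` are products of boundedly many atoms, taken from a finite alphabet. -/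
lemma IsAtomicMonoid.finite_divisors (hM : IsAtomicMonoid M)
    (hfin : {a : M | IsMonoidAtom a}.Finite) (x : M) : {u : M | u ∣ x}.Finite := by
  obtain ⟨n, hn⟩ := hM.2 x
  have : Finite {a : M // IsMonoidAtom a} := hfin
  refine ((List.finite_length_le {a : M // IsMonoidAtom a} n).image
    fun l => (l.map Subtype.val).prod).subset ?_
  rintro u ⟨v, rfl⟩
  obtain ⟨l, hl, rfl⟩ := hM.exists_list u
  obtain ⟨l', hl', rfl⟩ := hM.exists_list v
  have h := hn (l ++ l')
    (fun a ha => (List.mem_append.1 ha).elim (hl a) (hl' a)) List.prod_append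
  lift l to List {a : M // IsMonoidAtom a} using hl
  refine ⟨l, ?_, rfl⟩
  simp only [List.length_append, List.length_map] at h
  simp only [Set.mem_ofPred_eq]
  omega

lemma HasLatticeProperty.exists_join (h : HasLatticeProperty (Dvd.dvd : M → M → Prop)) (x y : M) :
    ∃ z, x ∣ z ∧ y ∣ z ∧ ∀ w, x ∣ w → y ∣ w → z ∣ w := by
  obtain ⟨z, hz, -⟩ := (h x y).1
  exact ⟨z, hz.1 x (by simp), hz.1 y (by simp), fun w hx hy => hz.2 w (by simp [hx, hy])⟩

lemma HasLatticeProperty.exists_meet (h : HasLatticeProperty (Dvd.dvd : M → M → Prop)) (x y : M) :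
    ∃ z, z ∣ x ∧ z ∣ y ∧ ∀ w, w ∣ x → w ∣ y → w ∣ z := by
  obtain ⟨z, hz, -⟩ := (h x y).2
  exact ⟨z, hz.1 x (by simp), hz.1 y (by simp), fun w hx hy => hz.2 w (by simp [hx, hy])⟩

lemma isJoin_pair_iff {x y z : M} :
    IsJoin Dvd.dvd {x, y} z ↔ x ∣ z ∧ y ∣ z ∧ ∀ w, x ∣ w → y ∣ w → z ∣ w := by
  simp [IsJoin, and_assoc]

/-! ### Quasi-central elements -/

/-- `e` is quasi-central: `M e ⊆ e M`. In a Garside monoid this amounts to `M e = e M`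
(see `IsQuasiCentral.exists_conj`). -/
def IsQuasiCentral (e : M) : Prop := ∀ v : M, e ∣ v * e

lemma IsQuasiCentral.one : IsQuasiCentral (1 : M) := fun _ => one_dvd _

lemma IsQuasiCentral.mul {e f : M} (he : IsQuasiCentral e) (hf : IsQuasiCentral f) :
    IsQuasiCentral (e * f) := by
  intro v
  obtain ⟨v', hv'⟩ := he v
  rw [← mul_assoc, hv', mul_assoc]
  exact mul_dvd_mul_left e (hf v')

lemma IsQuasiCentral.pow {e : M} (he : IsQuasiCentral e) (k : ℕ) : IsQuasiCentral (e ^ k) := by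
  induction k with
  | zero => simpa using IsQuasiCentral.one
  | succ k ih => rw [pow_succ]; exact ih.mul he

lemma IsQuasiCentral.mul_dvd_mul {e f x y : M} (he : IsQuasiCentral e) (hf : IsQuasiCentral f)
    (hx : x ∣ e) (hy : y ∣ f) : x * y ∣ e * f := by
  obtain ⟨u, rfl⟩ := hx
  rw [mul_assoc]
  exact mul_dvd_mul_left x (hy.trans (hf u))

lemma IsQuasiCentral.join {e f z : M} (he : IsQuasiCentral e) (hf : IsQuasiCentral f)
    (hz : IsJoin Dvd.dvd {e, f} z) : IsQuasiCentral z := by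
  obtain ⟨h1, h2, h3⟩ := isJoin_pair_iff.1 hz
  exact fun v => h3 _ ((he v).trans (mul_dvd_mul_left v h1)) ((hf v).trans (mul_dvd_mul_left v h2))

lemma IsQuasiCentral.map {e : M} (he : IsQuasiCentral e) (φ : M ≃* M) :
    IsQuasiCentral (φ e) := by
  intro v
  obtain ⟨u, hu⟩ := he (φ.symm v)
  exact ⟨φ u, by rw [← map_mul, ← hu, map_mul, φ.apply_symm_apply]⟩

/-- The part of the Garside axioms, for a central `z`, on which the analysis of quasi-central
elements rests. Only left-divisibility is used. -/
structure IsCentralGarside (z : M) : Prop where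
  atomic : IsAtomicMonoid M
  lattice : HasLatticeProperty (Dvd.dvd : M → M → Prop)
  finite : ∀ x : M, {u : M | u ∣ x}.Finite
  comm : ∀ x : M, x * z = z * x
  atom_dvd : ∀ a : M, IsMonoidAtom a → a ∣ z

lemma IsGarsideElement.isQuasiCentral {Δ : M} (hΔ : IsGarsideElement Δ) : IsQuasiCentral Δ := by
  intro x
  have hx : x ∈ Submonoid.closure {x : M | x ∣ Δ} := hΔ.generates ▸ Submonoid.mem_top x
  induction hx using Submonoid.closure_induction with
  | mem x hx =>
    obtain ⟨y, hy⟩ := hx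
    have h1 : y ∈ {x : M | x ∣ Δ} := by rw [hΔ.balanced]; exact ⟨x, hy⟩
    obtain ⟨x', hx'⟩ := h1
    exact ⟨x', by nth_rw 1 [hx', ← mul_assoc, ← hy]⟩
  | one => simp
  | mul x y _ _ hx hy =>
    obtain ⟨y', hy'⟩ := hy
    rw [mul_assoc, hy', ← mul_assoc]
    exact hx.mul_right _

lemma IsGarsideElement.atom_dvd {Δ : M} (hΔ : IsGarsideElement Δ) {a : M} (ha : IsMonoidAtom a) :
    a ∣ Δ := by
  have h : a ∈ Submonoid.closure {x : M | x ∣ Δ} := hΔ.generates ▸ Submonoid.mem_top a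
  obtain ⟨l, hl, hprod⟩ := Submonoid.exists_list_of_mem_closure h
  exact hl a (ha.mem_of_prod_eq l hprod)

/-- Conjugation by `Δ` permutes the finite set of divisors of `Δ`, so it has finite order, and a
power of `Δ` is central. -/
lemma IsGarsideElement.exists_isCentralGarside {Δ : M} (hΔ : IsGarsideElement Δ) :
    ∃ z : M, IsCentralGarside z := by
  have := hΔ.cancel
  have hconj : ∀ x : {x : M // x ∣ Δ}, ∃ y : {x : M // x ∣ Δ}, (x : M) * Δ = Δ * y := by
    rintro ⟨x, y, hy⟩
    have h1 : y ∈ {x : M | x ∣ Δ} := by rw [hΔ.balanced]; exact ⟨x, hy⟩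
    obtain ⟨x', hx'⟩ := h1
    have h2 : x' ∈ {x : M | x ∣ Δ} := by rw [hΔ.balanced]; exact ⟨y, hx'⟩
    refine ⟨⟨x', h2⟩, ?_⟩
    calc x * Δ = x * (y * x') := by rw [← hx']
      _ = Δ * x' := by rw [← mul_assoc, ← hy]
  choose ψ hψ using hconj
  have hfin : Finite {x : M // x ∣ Δ} := hΔ.finite_divisors
  have hinj : Function.Injective ψ := fun x y hxy =>
    Subtype.ext (mul_right_cancel (b := Δ) (by rw [hψ, hψ, hxy]))
  let σ : Equiv.Perm {x : M // x ∣ Δ} :=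
    Equiv.ofBijective ψ (Finite.injective_iff_bijective.1 hinj)
  have hpow : ∀ (n : ℕ) (x : {x : M // x ∣ Δ}), (x : M) * Δ ^ n = Δ ^ n * ((σ ^ n) x : M) := by
    intro n
    induction n with
    | zero => simp
    | succ n ih =>
      intro x
      have hs : ((σ ^ n) x : M) * Δ = Δ * ((σ ^ (n + 1)) x : M) := by
        rw [hψ, pow_succ', Equiv.Perm.mul_apply]
        rfl
      rw [pow_succ, ← mul_assoc, ih, mul_assoc, hs, mul_assoc]
  have hatoms : {a : M | IsMonoidAtom a}.Finite :=
    hΔ.finite_divisors.subset fun a ha => hΔ.atom_dvd ha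
  refine ⟨Δ ^ orderOf σ, hΔ.atomic, hΔ.left_lattice, hΔ.atomic.finite_divisors hatoms, ?_, ?_⟩
  · intro x
    have hx : x ∈ Submonoid.closure {x : M | x ∣ Δ} := hΔ.generates ▸ Submonoid.mem_top x
    induction hx using Submonoid.closure_induction with
    | mem x hx => simpa [pow_orderOf_eq_one] using hpow (orderOf σ) ⟨x, hx⟩
    | one => simp
    | mul x y _ _ hx hy => rw [mul_assoc, hy, ← mul_assoc, hx, mul_assoc]
  · intro a ha
    exact (hΔ.atom_dvd ha).trans (dvd_pow_self _ (orderOf_pos σ).ne')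

/-! ### Conjugation and quotients -/

variable {z : M}

namespace IsCentralGarside

lemma isQuasiCentral (hz : IsCentralGarside z) : IsQuasiCentral z :=
  fun v => ⟨v, hz.comm v⟩

lemma exists_dvd_pow (hz : IsCentralGarside z) (x : M) : ∃ k : ℕ, x ∣ z ^ k := by
  have hx : x ∈ Submonoid.closure {a : M | IsMonoidAtom a} := hz.atomic.1 ▸ Submonoid.mem_top x
  induction hx using Submonoid.closure_induction with
  | mem x hx => exact ⟨1, by simpa using hz.atom_dvd x hx⟩
  | one => exact ⟨0, one_dvd _⟩
  | mul x y _ _ hx hy =>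
    obtain ⟨k, hk⟩ := hx
    obtain ⟨l, hl⟩ := hy
    exact ⟨k + l, by
      rw [pow_add]
      exact (hz.isQuasiCentral.pow k).mul_dvd_mul (hz.isQuasiCentral.pow l) hk hl⟩

end IsCentralGarside

/-- Conjugation by a quasi-central element is an automorphism. It fixes the central powers of `z`,
hence maps the finite set of divisors of `z ^ k` injectively into itself, which gives
surjectivity. -/
lemma IsQuasiCentral.exists_conj [IsCancelMul M] (hz : IsCentralGarside z) {e : M} (he : IsQuasiCentral e) :
    ∃ φ : M ≃* M, ∀ v, v * e = e * φ v := by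
  choose φ hφ using he
  have hmul : ∀ v w, φ (v * w) = φ v * φ w := fun v w =>
    mul_left_cancel (a := e) (by
      rw [← hφ, mul_assoc, hφ w, ← mul_assoc, hφ v, mul_assoc])
  have hinj : Function.Injective φ := fun v w h =>
    mul_right_cancel (b := e) (by rw [hφ, hφ, h])
  have hsurj : Function.Surjective φ := by
    intro y
    obtain ⟨k, hk⟩ := hz.exists_dvd_pow y
    have hzk : φ (z ^ k) = z ^ k := by
      have hc : Commute e (z ^ k) := Commute.pow_right (hz.comm e) k
      exact mul_left_cancel (a := e) (by rw [← hφ, hc.eq])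
    have hmaps : ∀ v : {v : M // v ∣ z ^ k}, φ v ∣ z ^ k := by
      rintro ⟨v, w, hw⟩
      exact ⟨φ w, by rw [← hmul, ← hw, hzk]⟩
    have hfin : Finite {v : M // v ∣ z ^ k} := hz.finite _
    have hbij : Function.Surjective
        (fun v : {v : M // v ∣ z ^ k} => (⟨φ v, hmaps v⟩ : {v : M // v ∣ z ^ k})) :=
      Finite.injective_iff_surjective.1 fun v w h => Subtype.ext (hinj (congrArg Subtype.val h))
    obtain ⟨v, hv⟩ := hbij ⟨y, hk⟩
    exact ⟨v, congrArg Subtype.val hv⟩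
  exact ⟨MulEquiv.ofBijective (⟨φ, hmul⟩ : M →ₙ* M) ⟨hinj, hsurj⟩, hφ⟩

lemma IsQuasiCentral.of_mul [IsCancelMul M] (hz : IsCentralGarside z) {e f : M} (he : IsQuasiCentral e)
    (hef : IsQuasiCentral (e * f)) : IsQuasiCentral f := by
  obtain ⟨φ, hφ⟩ := he.exists_conj hz
  intro v
  -- `e * (v * f) = φ⁻¹ v * (e * f)` is a multiple of `e * f`.
  refine dvd_of_mul_dvd_mul_left (a := e) ?_
  have h := hef (φ.symm v)
  rwa [← mul_assoc (φ.symm v), hφ, φ.apply_symm_apply, mul_assoc e v f] at h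

/-- The number of left-divisors of `x`. It is strictly monotone for divisibility, and invariant
under automorphisms. -/
noncomputable def divisorCount (x : M) : ℕ := {u : M | u ∣ x}.ncard

lemma IsCentralGarside.divisorCount_mono (hz : IsCentralGarside z) {x y : M} (h : x ∣ y) :
    divisorCount x ≤ divisorCount y :=
  Set.ncard_le_ncard (fun _ hu => hu.trans h) (hz.finite y)

lemma IsCentralGarside.divisorCount_lt [IsCancelMul M] (hz : IsCentralGarside z) {x y : M} (h : x ∣ y)
    (hne : x ≠ y) : divisorCount x < divisorCount y :=
  Set.ncard_lt_ncard ⟨fun _ hu => hu.trans h,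
    fun hs => hne (hz.atomic.dvd_antisymm h (hs (dvd_refl y)))⟩ (hz.finite y)


lemma divisorCount_map (φ : M ≃* M) (x : M) : divisorCount (φ x) = divisorCount x := by
  have h : {u : M | u ∣ φ x} = φ '' {u : M | u ∣ x} := by
    ext u
    constructor
    · rintro ⟨v, hv⟩
      exact ⟨φ.symm u, ⟨φ.symm v, by rw [← map_mul, ← hv, φ.symm_apply_apply]⟩,
        φ.apply_symm_apply u⟩
    · rintro ⟨w, hw, rfl⟩
      exact map_dvd φ hw
  rw [divisorCount, h, Set.ncard_image_of_injective _ φ.injective, divisorCount]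

/-! ### The elements `Δ_x` -/

/-- A bounded set has a join: an upper bound with the fewest divisors is the least one, since
upper bounds are closed under meets. -/
lemma IsCentralGarside.exists_isJoin [IsCancelMul M] (hz : IsCentralGarside z) {S : Set M} {b : M}
    (hb : ∀ s ∈ S, s ∣ b) : ∃ d, IsJoin Dvd.dvd S d := by
  obtain ⟨d, hd, hmin⟩ := (measure (divisorCount (M := M))).wf.has_min
    {w | ∀ s ∈ S, s ∣ w} ⟨b, hb⟩
  refine ⟨d, hd, fun w hw => ?_⟩
  obtain ⟨m, hmd, hmw, hm⟩ := hz.lattice.exists_meet d w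
  have h1 : m = d := by
    by_contra hne
    exact hmin m (fun s hs => hm s (hd s hs) (hw s hs)) (hz.divisorCount_lt hmd hne)
  exact h1 ▸ hmw

lemma IsComplementOf.dvd_of_dvd [IsCancelMul M] {x y c e : M} (hc : IsComplementOf y x c)
    (he : IsQuasiCentral e) (hx : x ∣ e) : c ∣ e :=
  dvd_of_mul_dvd_mul_left ((isJoin_pair_iff.1 hc).2.2 (y * e) (hx.trans (he y)) (dvd_mul_right y e))

lemma IsCentralGarside.exists_isComplementOf (hz : IsCentralGarside z) (y x : M) :
    ∃ c, IsComplementOf y x c := by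
  obtain ⟨j, h1, h2, h3⟩ := hz.lattice.exists_join x y
  obtain ⟨c, rfl⟩ := h2
  exact ⟨c, isJoin_pair_iff.2 ⟨h1, dvd_mul_right y c, h3⟩⟩

lemma IsCentralGarside.exists_isLocalDelta [IsCancelMul M] (hz : IsCentralGarside z) (x : M) :
    ∃ d, IsLocalDelta x d := by
  obtain ⟨k, hk⟩ := hz.exists_dvd_pow x
  refine hz.exists_isJoin (b := z ^ k) ?_
  rintro c ⟨y, hc⟩
  exact hc.dvd_of_dvd (hz.isQuasiCentral.pow k) hk

namespace IsLocalDelta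

lemma dvd_self {x d : M} (hd : IsLocalDelta x d) : x ∣ d :=
  hd.1 x ⟨1, isJoin_pair_iff.2 ⟨by simp, one_dvd _, fun w hw _ => by simpa using hw⟩⟩

/-- `Δ_x` divides every quasi-central multiple of `x`. -/
lemma dvd_of_dvd [IsCancelMul M] {x d e : M} (hd : IsLocalDelta x d) (he : IsQuasiCentral e)
    (hx : x ∣ e) : d ∣ e :=
  hd.2 e fun _ ⟨_, hc⟩ => hc.dvd_of_dvd he hx

/-- `Δ_x` is quasi-central, as `y \ x` divides `v * ((y * v) \ x)` for all `y` and `v`. -/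
lemma isQuasiCentral [IsCancelMul M] (hz : IsCentralGarside z) {x d : M} (hd : IsLocalDelta x d) :
    IsQuasiCentral d := by
  intro v
  refine hd.2 _ ?_
  rintro c ⟨y, hc⟩
  obtain ⟨c', hc'⟩ := hz.exists_isComplementOf (y * v) x
  have h1 : c ∣ v * c' := by
    refine dvd_of_mul_dvd_mul_left (a := y) ((isJoin_pair_iff.1 hc).2.2 _ ?_ (dvd_mul_right _ _))
    rw [← mul_assoc]
    exact (isJoin_pair_iff.1 hc').1
  exact h1.trans (mul_dvd_mul_left v (hd.1 c' ⟨_, hc'⟩))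

/-- For an atom `a`, the element `Δ_a` is minimal among non-trivial quasi-central elements. -/
lemma eq_of_dvd [IsCancelMul M] (hz : IsCentralGarside z) {a d e : M} (ha : IsMonoidAtom a)
    (hd : IsLocalDelta a d) (he : IsQuasiCentral e) (he1 : e ≠ 1) (hed : e ∣ d) : e = d := by
  by_cases hae : a ∣ e
  · exact hz.atomic.dvd_antisymm hed (hd.dvd_of_dvd he hae)
  exfalso
  obtain ⟨f, rfl⟩ := hed
  have hf : IsQuasiCentral f := he.of_mul hz (hd.isQuasiCentral hz)
  obtain ⟨φ, hφ⟩ := he.exists_conj hz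
  obtain ⟨c, hc⟩ := hz.exists_isComplementOf e a
  obtain ⟨h1, h2, h3⟩ := isJoin_pair_iff.1 hc
  -- The complement `e \ a` divides the atom `φ a`, and is not `1`, so it is `φ a`.
  have hcφ : c ∣ φ a := dvd_of_mul_dvd_mul_left (h3 (e * φ a) (hφ a ▸ dvd_mul_right a e)
    (dvd_mul_right _ _))
  have hφc : φ.symm c = a := by
    obtain ⟨t, ht⟩ := hcφ
    have ht' : a = φ.symm c * φ.symm t := by rw [← map_mul, ← ht, φ.symm_apply_apply]
    rcases ha.2 _ _ ht' with h | h
    · rw [(map_eq_one_iff _ φ.symm.injective).1 h, mul_one] at h1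
      exact absurd h1 hae
    · rw [ht', h, mul_one]
  have hcf : c ∣ f := dvd_of_mul_dvd_mul_left (h3 (e * f) hd.dvd_self (dvd_mul_right _ _))
  have haf : a ∣ φ.symm f := by
    obtain ⟨t, rfl⟩ := hcf
    rw [map_mul, hφc]
    exact dvd_mul_right _ _
  -- Hence `Δ_a = e * f` divides a conjugate of `f`, which has too few divisors.
  have hdf : e * f ∣ φ.symm f := hd.dvd_of_dvd (hf.map φ.symm) haf
  have hlt : divisorCount f < divisorCount (e * f) :=
    hz.divisorCount_lt (hf e) fun h => he1 (mul_right_cancel (b := f) (by rw [one_mul, ← h]))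
  have hle := hz.divisorCount_mono hdf
  rw [divisorCount_map] at hle
  omega

/-- For an atom `a`, the element `Δ_a` is prime. -/
lemma dvd_or_dvd [IsCancelMul M] (hz : IsCentralGarside z) {a d f g : M} (ha : IsMonoidAtom a)
    (hd : IsLocalDelta a d) (hf : IsQuasiCentral f) (h : d ∣ f * g) : d ∣ f ∨ d ∣ g := by
  obtain ⟨c, hc⟩ := hz.exists_isComplementOf f d
  obtain ⟨h1, h2, h3⟩ := isJoin_pair_iff.1 hc
  have hdq := hd.isQuasiCentral hz
  have hcq : IsQuasiCentral c := hf.of_mul hz (hdq.join hf hc)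
  by_cases hc1 : c = 1
  · left
    rwa [hc1, mul_one] at h1
  · right
    -- `f \ d` is a non-trivial quasi-central divisor of `d`.
    have hcd : c = d := hd.eq_of_dvd hz ha hcq hc1 (hc.dvd_of_dvd hdq (dvd_refl d))
    exact hcd ▸ dvd_of_mul_dvd_mul_left (h3 (f * g) h (dvd_mul_right _ _))

lemma dvd_of_dvd_pow [IsCancelMul M] (hz : IsCentralGarside z) {a d f : M} (ha : IsMonoidAtom a)
    (hd : IsLocalDelta a d) (hf : IsQuasiCentral f) {k : ℕ} (h : d ∣ f ^ k) : d ∣ f := by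
  induction k with
  | zero => exact (pow_zero f ▸ h).trans (one_dvd f)
  | succ k ih =>
    rw [pow_succ] at h
    exact (hd.dvd_or_dvd hz ha (hf.pow k) h).elim ih id

lemma eq_of_dvd_of_atom [IsCancelMul M] (hz : IsCentralGarside z) {a b d d' : M}
    (ha : IsMonoidAtom a) (hb : IsMonoidAtom b) (hd : IsLocalDelta a d) (hd' : IsLocalDelta b d')
    (h : b ∣ d) : d' = d := by
  refine hd.eq_of_dvd hz ha (hd'.isQuasiCentral hz) ?_ (hd'.dvd_of_dvd (hd.isQuasiCentral hz) h)
  rintro rfl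
  exact hb.1 (hz.atomic.eq_one_of_dvd_one hd'.dvd_self)

end IsLocalDelta

/-! ### Zappa–Szép products from coprime quasi-central elements -/

/-- The submonoid of divisors of powers of a quasi-central element `e`. -/
def powDivisors (e : M) (he : IsQuasiCentral e) : Submonoid M where
  carrier := {x | ∃ k : ℕ, x ∣ e ^ k}
  one_mem' := ⟨0, one_dvd _⟩
  mul_mem' := by
    rintro x y ⟨k, hk⟩ ⟨l, hl⟩
    exact ⟨k + l, by rw [pow_add]; exact (he.pow k).mul_dvd_mul (he.pow l) hk hl⟩

section Coprime

variable {d e : M}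

/-- If powers of `d` and `e` have only the trivial common divisor, a divisor `h` of a power of `e`
can be dropped from `g₂ ∣ g₁ * h`, where `g₂` divides a power of `d`: the complement `g₁ \ g₂` divides both
powers. -/
lemma dvd_of_dvd_mul_of_coprime [IsCancelMul M] (hz : IsCentralGarside z) (hd : IsQuasiCentral d)
    (hcop : ∀ x j k, x ∣ d ^ j → x ∣ e ^ k → x = 1) {g₁ g₂ h : M} {j k : ℕ}
    (hg₂ : g₂ ∣ d ^ j) (hh : h ∣ e ^ k) (hdvd : g₂ ∣ g₁ * h) : g₂ ∣ g₁ := by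
  obtain ⟨c, hc⟩ := hz.exists_isComplementOf g₁ g₂
  obtain ⟨h1, h2, h3⟩ := isJoin_pair_iff.1 hc
  have hcd : c ∣ d ^ j := hc.dvd_of_dvd (hd.pow j) hg₂
  have hch : c ∣ h := dvd_of_mul_dvd_mul_left (h3 _ hdvd (dvd_mul_right _ _))
  rw [hcop c j k hcd (hch.trans hh), mul_one] at h1
  exact h1

/-- Unique decomposition for divisors of powers of coprime quasi-central elements. -/
lemma eq_of_mul_eq_mul_of_coprime [IsCancelMul M] (hz : IsCentralGarside z)
    (hd : IsQuasiCentral d) (hcop : ∀ x j k, x ∣ d ^ j → x ∣ e ^ k → x = 1)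
    {g₁ g₂ h₁ h₂ : M} {j k₁ k₂ : ℕ} (hg₁ : g₁ ∣ d ^ j) (hg₂ : g₂ ∣ d ^ j)
    (hh₁ : h₁ ∣ e ^ k₁) (hh₂ : h₂ ∣ e ^ k₂) (h : g₁ * h₁ = g₂ * h₂) : g₁ = g₂ :=
  hz.atomic.dvd_antisymm
    (dvd_of_dvd_mul_of_coprime hz hd hcop hg₁ hh₂ (h ▸ dvd_mul_right _ _))
    (dvd_of_dvd_mul_of_coprime hz hd hcop hg₂ hh₁ (h ▸ dvd_mul_right _ _))

/-- A product `h * g'` can be rewritten as `g * h'`. For fixed `h` the complement map `g ↦ h \ g`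
sends the finite set of divisors of `d ^ j` injectively into itself, so `g' = h \ g` for
some `g`. -/
lemma exists_exchange [IsCancelMul M] (hz : IsCentralGarside z) (hd : IsQuasiCentral d)
    (he : IsQuasiCentral e) (hcop : ∀ x j k, x ∣ d ^ j → x ∣ e ^ k → x = 1)
    {h g' : M} {j k : ℕ} (hh : h ∣ e ^ k) (hg' : g' ∣ d ^ j) :
    ∃ g h', g ∣ d ^ j ∧ h' ∣ e ^ k ∧ h * g' = g * h' := by
  have hex : ∀ g : {g : M // g ∣ d ^ j}, ∃ c : {g : M // g ∣ d ^ j}, ∃ h', h' ∣ e ^ k ∧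
      h * c = g * h' := by
    rintro ⟨g, hg⟩
    obtain ⟨c, hc⟩ := hz.exists_isComplementOf h g
    obtain ⟨h1, h2, h3⟩ := isJoin_pair_iff.1 hc
    obtain ⟨h', hh'⟩ := h1
    refine ⟨⟨c, hc.dvd_of_dvd (hd.pow j) hg⟩, h', ?_, hh'⟩
    have hc' : IsComplementOf g h h' :=
      isJoin_pair_iff.2 ⟨hh' ▸ h2, dvd_mul_right _ _, fun w hw hw' => hh' ▸ h3 w hw' hw⟩
    exact hc'.dvd_of_dvd (he.pow k) hh
  choose f hf using hex
  have hinj : Function.Injective f := by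
    intro g₁ g₂ h12
    obtain ⟨h₁, hh₁, e₁⟩ := hf g₁
    obtain ⟨h₂, hh₂, e₂⟩ := hf g₂
    exact Subtype.ext (eq_of_mul_eq_mul_of_coprime hz hd hcop g₁.2 g₂.2 hh₁ hh₂
      (by rw [← e₁, ← e₂, h12]))
  have hfin : Finite {g : M // g ∣ d ^ j} := hz.finite _
  obtain ⟨g, hg⟩ := Finite.injective_iff_surjective.1 hinj ⟨g', hg'⟩
  obtain ⟨h', hh', heq⟩ := hf g
  exact ⟨g, h', g.2, hh', by rw [← heq, hg]⟩

lemma existsUnique_decomposition [IsCancelMul M] (hz : IsCentralGarside z)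
    (hd : IsQuasiCentral d) (he : IsQuasiCentral e)
    (hcop : ∀ x j k, x ∣ d ^ j → x ∣ e ^ k → x = 1)
    (hatom : ∀ a, IsMonoidAtom a → a ∣ d ∨ a ∣ e) (x : M) :
    ∃! p : powDivisors d hd × powDivisors e he, (p.1 : M) * (p.2 : M) = x := by
  have hex : ∃ g ∈ powDivisors d hd, ∃ h ∈ powDivisors e he, g * h = x := by
    have hx : x ∈ Submonoid.closure {a : M | IsMonoidAtom a} := hz.atomic.1 ▸ Submonoid.mem_top x
    induction hx using Submonoid.closure_induction_right with
    | one => exact ⟨1, one_mem _, 1, one_mem _, mul_one 1⟩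
    | mul_right x _ a ha ih =>
      obtain ⟨g, hg, h, hh, rfl⟩ := ih
      rcases hatom a ha with had | hae
      · obtain ⟨k, hk⟩ := hh
        obtain ⟨g₁, h₁, hg₁, hh₁, heq⟩ := exists_exchange hz hd he hcop hk
          (show a ∣ d ^ 1 by rwa [pow_one])
        exact ⟨g * g₁, mul_mem hg ⟨_, hg₁⟩, h₁, ⟨_, hh₁⟩, by rw [mul_assoc, ← heq, mul_assoc]⟩
      · exact ⟨g, hg, h * a, mul_mem hh ⟨1, by rwa [pow_one]⟩, (mul_assoc _ _ _).symm⟩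
  obtain ⟨g, hg, h, hh, rfl⟩ := hex
  refine ⟨(⟨g, hg⟩, ⟨h, hh⟩), rfl, ?_⟩
  rintro ⟨⟨g₂, hg₂⟩, ⟨h₂, hh₂⟩⟩ heq
  obtain ⟨j, hj⟩ := hg
  obtain ⟨j₂, hj₂⟩ := hg₂
  obtain ⟨k, hk⟩ := hh
  obtain ⟨k₂, hk₂⟩ := hh₂
  have heq' : g₂ * h₂ = g * h := heq
  obtain rfl : g₂ = g := eq_of_mul_eq_mul_of_coprime (j := j + j₂) hz hd hcop
    (hj₂.trans (pow_dvd_pow d (by omega))) (hj.trans (pow_dvd_pow d (by omega)))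
    hk₂ hk heq'
  obtain rfl : h₂ = h := mul_left_cancel heq'
  rfl

end Coprime

lemma isZappaSzep_powDivisors [IsCancelMul M] (hz : IsCentralGarside z) {d e : M}
    (hd : IsQuasiCentral d) (he : IsQuasiCentral e)
    (hcop : ∀ x j k, x ∣ d ^ j → x ∣ e ^ k → x = 1)
    (hatom : ∀ a, IsMonoidAtom a → a ∣ d ∨ a ∣ e) :
    IsZappaSzep (powDivisors d hd) (powDivisors e he) := fun x =>
  ⟨existsUnique_decomposition hz hd he hcop hatom x,
    existsUnique_decomposition hz he hd (fun x j k hj hk => hcop x k j hk hj)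
      (fun a ha => (hatom a ha).symm) x⟩

/-- A quasi-central element can be stripped of its factors `d`. -/
lemma IsQuasiCentral.exists_eq_pow_mul [IsCancelMul M] (hz : IsCentralGarside z) {d : M}
    (hd : IsQuasiCentral d) (hd1 : d ≠ 1) (f : M) (hf : IsQuasiCentral f) :
    ∃ (m : ℕ) (e : M), IsQuasiCentral e ∧ ¬ d ∣ e ∧ f = d ^ m * e := by
  induction hn : divisorCount f using Nat.strong_induction_on generalizing f with
  | _ n ih =>
    by_cases hdf : d ∣ f
    · obtain ⟨f', rfl⟩ := hdf
      have hf' : IsQuasiCentral f' := hd.of_mul hz hf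
      have hlt : divisorCount f' < divisorCount (d * f') :=
        hz.divisorCount_lt (hf' d)
          fun h => hd1 (mul_right_cancel (b := f') (by rw [one_mul, ← h]))
      obtain ⟨m, e, he, hde, rfl⟩ := ih _ (hn ▸ hlt) f' hf' rfl
      exact ⟨m + 1, e, he, hde, by rw [pow_succ', mul_assoc]⟩
    · exact ⟨0, f, hf, hdf, by simp⟩

/-- If `Δ_a ≠ Δ_b` for some atoms `a` and `b`, then `M` is decomposable. -/
lemma IsCentralGarside.exists_isZappaSzep [IsCancelMul M] (hz : IsCentralGarside z) {a b d d' : M}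
    (ha : IsMonoidAtom a) (hb : IsMonoidAtom b) (hd : IsLocalDelta a d) (hd' : IsLocalDelta b d')
    (hne : d' ≠ d) : ∃ G H : Submonoid M, G ≠ ⊥ ∧ H ≠ ⊥ ∧ IsZappaSzep G H := by
  have hdq := hd.isQuasiCentral hz
  have hd1 : d ≠ 1 := by
    rintro rfl
    exact ha.1 (hz.atomic.eq_one_of_dvd_one hd.dvd_self)
  obtain ⟨m, e, he, hde, hzde⟩ := hdq.exists_eq_pow_mul hz hd1 z hz.isQuasiCentral
  have hatom : ∀ c, IsMonoidAtom c → c ∣ d ∨ c ∣ e := by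
    intro c hc
    obtain ⟨δ, hδ⟩ := hz.exists_isLocalDelta c
    have h1 : δ ∣ d ^ m * e := hzde ▸ hδ.dvd_of_dvd hz.isQuasiCentral (hz.atom_dvd c hc)
    exact (hδ.dvd_or_dvd hz hc (hdq.pow m) h1).imp
      (fun h => hδ.dvd_self.trans (hδ.dvd_of_dvd_pow hz hc hdq h)) fun h => hδ.dvd_self.trans h
  have hcop : ∀ x j k, x ∣ d ^ j → x ∣ e ^ k → x = 1 := by
    intro x j k hj hk
    by_contra hx
    obtain ⟨c, hc, hcx⟩ := hz.atomic.exists_atom_dvd hx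
    obtain ⟨δ, hδ⟩ := hz.exists_isLocalDelta c
    have h1 : δ ∣ d := hδ.dvd_of_dvd_pow hz hc hdq (hδ.dvd_of_dvd (hdq.pow j) (hcx.trans hj))
    have h2 : δ ∣ e := hδ.dvd_of_dvd_pow hz hc he (hδ.dvd_of_dvd (he.pow k) (hcx.trans hk))
    exact hde (hd.eq_of_dvd_of_atom hz ha hc hδ (hδ.dvd_self.trans h1) ▸ h2)
  have hbe : b ∣ e := (hatom b hb).resolve_left fun h =>
    hne (hd.eq_of_dvd_of_atom hz ha hb hd' h)
  refine ⟨powDivisors d hdq, powDivisors e he, fun h => ha.1 ?_, fun h => hb.1 ?_,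
    isZappaSzep_powDivisors hz hdq he hcop hatom⟩
  · exact (Submonoid.mem_bot (M := M)).1 (h ▸ ⟨1, by simpa using hd.dvd_self⟩)
  · exact (Submonoid.mem_bot (M := M)).1 (h ▸ ⟨1, by simpa using hbe⟩)

/-! ### Zappa–Szép products are not `Δ`-pure -/

namespace IsZappaSzep

variable {G H : Submonoid M}

lemma symm (h : IsZappaSzep G H) : IsZappaSzep H G := fun k => ⟨(h k).2, (h k).1⟩

lemma exists_mul (h : IsZappaSzep G H) (k : M) : ∃ g ∈ G, ∃ t ∈ H, g * t = k := by
  obtain ⟨⟨g, t⟩, hk, -⟩ := (h k).1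
  exact ⟨g, g.2, t, t.2, hk⟩

lemma unique (h : IsZappaSzep G H) {g g' t t' : M} (hg : g ∈ G) (hg' : g' ∈ G) (ht : t ∈ H)
    (ht' : t' ∈ H) (heq : g * t = g' * t') : g = g' ∧ t = t' := by
  have := (h (g' * t')).1.unique (y₁ := (⟨g, hg⟩, ⟨t, ht⟩)) (y₂ := (⟨g', hg'⟩, ⟨t', ht'⟩)) heq rfl
  simpa using this

lemma eq_one (h : IsZappaSzep G H) {x : M} (hG : x ∈ G) (hH : x ∈ H) : x = 1 :=
  (h.unique hG (one_mem G) (one_mem H) hH (by simp)).1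

/-- The factors of a Zappa–Szép decomposition are closed under left factors. -/
lemma mem_of_mul_mem (h : IsZappaSzep G H) (hM : IsAtomicMonoid M) {k l : M} (hkl : k * l ∈ G) :
    k ∈ G := by
  obtain ⟨g₁, hg₁, t₁, ht₁, rfl⟩ := h.exists_mul k
  obtain ⟨g₂, hg₂, t₂, ht₂, rfl⟩ := h.exists_mul l
  obtain ⟨g₃, hg₃, t₃, ht₃, h3⟩ := h.exists_mul (t₁ * g₂)
  have h1 : (g₁ * g₃) * (t₃ * t₂) = (g₁ * t₁ * (g₂ * t₂)) * 1 := by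
    rw [mul_one, mul_assoc, ← mul_assoc g₃, h3]
    simp only [mul_assoc]
  have h2 := (h.unique (mul_mem hg₁ hg₃) hkl (mul_mem ht₃ ht₂) (one_mem H) h1).2
  -- So `t₁ * g₂ = 1 * g₃`, and uniqueness for `H * G` gives `t₁ = 1`.
  have h4 : t₁ = 1 := (h.symm.unique ht₁ (one_mem H) hg₂ hg₃
    (by rw [← h3, (hM.eq_one_of_mul_eq_one h2).1, mul_one, one_mul])).1
  rwa [h4, mul_one]

lemma mem_of_dvd (h : IsZappaSzep G H) (hM : IsAtomicMonoid M) {k g : M} (hg : g ∈ G)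
    (hk : k ∣ g) : k ∈ G := by
  obtain ⟨l, rfl⟩ := hk
  exact h.mem_of_mul_mem hM hg

lemma dvd_of_dvd_mul (h : IsZappaSzep G H) {g p q : M} (hg : g ∈ G) (hp : p ∈ G) (hq : q ∈ H)
    (hdvd : g ∣ p * q) : g ∣ p := by
  obtain ⟨u, hu⟩ := hdvd
  obtain ⟨u₁, hu₁, u₂, hu₂, rfl⟩ := h.exists_mul u
  exact ⟨u₁, (h.unique hp (mul_mem hg hu₁) hq hu₂ (by rw [hu, mul_assoc])).1⟩

/-- The `G`-component of a quasi-central element is quasi-central. -/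
lemma isQuasiCentral_left (h : IsZappaSzep G H) {p q : M} (hp : p ∈ G) (hq : q ∈ H)
    (hpq : IsQuasiCentral (p * q)) : IsQuasiCentral p := by
  intro y
  obtain ⟨y', hy'⟩ := hpq y
  obtain ⟨g₁, hg₁, t₁, ht₁, h1⟩ := h.exists_mul (y * p)
  have h2 : p ∣ g₁ := by
    refine h.dvd_of_dvd_mul hp hg₁ (mul_mem ht₁ hq) ⟨q * y', ?_⟩
    rw [← mul_assoc, h1, mul_assoc, hy', mul_assoc]
  exact h2.trans ⟨t₁, h1.symm⟩

/-- A non-trivial factor `G` contains an atom `a`, and `Δ_a ∈ G`: it divides the `G`-component of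
`Δ`, which is quasi-central. -/
lemma exists_atom [IsCancelMul M] (h : IsZappaSzep G H) {Δ : M} (hΔ : IsGarsideElement Δ)
    (hG : G ≠ ⊥) : ∃ a, IsMonoidAtom a ∧ ∀ d, IsLocalDelta a d → d ∈ G := by
  obtain ⟨x, hx, hx1⟩ : ∃ x ∈ G, x ≠ 1 := by
    by_contra! hall
    exact hG ((Submonoid.eq_bot_iff_forall G).2 hall)
  obtain ⟨a, ha, hax⟩ := hΔ.atomic.exists_atom_dvd hx1
  have haG : a ∈ G := h.mem_of_dvd hΔ.atomic hx hax
  obtain ⟨p, hp, q, hq, hpq⟩ := h.exists_mul Δ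
  have hap : a ∣ p := h.dvd_of_dvd_mul haG hp hq (hpq ▸ hΔ.atom_dvd ha)
  have hpc : IsQuasiCentral p := h.isQuasiCentral_left hp hq (hpq ▸ hΔ.isQuasiCentral)
  exact ⟨a, ha, fun d hd => h.mem_of_dvd hΔ.atomic hp (hd.dvd_of_dvd hpc hap)⟩

end IsZappaSzep

end Garside

theorem theoremT {M : Type*} [Monoid M] (hM : Garside.IsGarsideMonoid M) :
    Garside.IsDeltaPure M ↔ Garside.IsZappaSzepIndecomposable M := by
  obtain ⟨Δ, hΔ⟩ := hM
  have := hΔ.cancel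
  constructor
  · rintro hpure ⟨G, H, hG, hH, hGH⟩
    obtain ⟨a, ha, haG⟩ := hGH.exists_atom hΔ hG
    obtain ⟨b, hb, hbH⟩ := hGH.symm.exists_atom hΔ hH
    obtain ⟨d, had, hbd⟩ := hpure a b ha hb
    have hd1 : d = 1 := hGH.eq_one (haG d had) (hbH d hbd)
    exact ha.1 (hΔ.atomic.eq_one_of_dvd_one (hd1 ▸ had.dvd_self))
  · intro hind a b ha hb
    obtain ⟨z, hz⟩ := hΔ.exists_isCentralGarside
    obtain ⟨d, hd⟩ := hz.exists_isLocalDelta a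
    obtain ⟨d', hd'⟩ := hz.exists_isLocalDelta b
    by_contra hne
    exact hind (hz.exists_isZappaSzep ha hb hd hd' fun h => hne ⟨d, hd, h ▸ hd'⟩)
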